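/- **Languages.** Call-by-name PCF has types $A ::= \mathsf{nat}\mid A\times A\mid A\to A$ and simply typed terms: variables, numerals $\underline n$ ($n\in\mathbb N$), $M\mathbin{\mathbf{op}}N:\mathsf{nat}$ with $\mathbf{op}\in\{+,-,*,\div,\bmod\}$, $\mathsf{ifz}(N,P,Q)$ (with $P,Q$ of any common type), pairs $\langle M,N\rangle$, projections $\pi_i(M)$, $\lambda x.M$, $M\,N$, and $\mathsf{fix}\,x.M$ at every type. The operations are total on $\mathbb N$: subtraction is truncated, $\div$ is floor division, and $m\div 0=m\bmod 0=0$. Terms are identified up to $\alpha$-equivalence. The judgment $M\Downarrow^n V$ ("the closed term $M$ evaluates to $V$ with cost $n$") is call-by-name big-step evaluation: numerals, pairs and abstractions evaluate to themselves at cost $0$; $M\mathbin{\mathbf{op}}N$ evaluates both operands to numerals; $\mathsf{ifz}(N,P,Q)$ evaluates $N$ and then $P$ if the result is $\underline 0$ and $Q$ otherwise; $\pi_i(M)$ evaluates $M$ to a pair and then its $i$-th component; $M\,N$ evaluates $M$ to some $\lambda x.P$ and then $P[N/x]$; $\mathsf{fix}\,x.M$ evaluates $M[\mathsf{fix}\,x.M/x]$.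 The cost is the sum of the costs of the premises, plus $1$ for each projection and each application. The recurrence language PCFc has an additional type $\mathbb C$ and additional terms $\mathbf 0,\mathbf 1:\mathbb C$ and $M\boxplus N:\mathbb C$ (for $M,N:\mathbb C$). Its evaluation $M\Downarrow V$ is given by the same rules without costs, together with $\mathbf 0\Downarrow\mathbf 0$, $\mathbf 1\Downarrow\mathbf 1$, and $M\boxplus N\Downarrow V\boxplus W$ whenever $M\Downarrow V$ and $N\Downarrow W$. Write $M{\downarrow}$ if $M\Downarrow V$ for some $V$. Let $\underline 0^{\mathbb C}=\mathbf 0$ and $\underline{n+1}^{\mathbb C}=\mathbf 1\boxplus\underline n^{\mathbb C}$. Let $\mathsf{fix}_0x.M=\mathsf{fix}\,x.x$ and $\mathsf{fix}_{n+1}x.M=M[\mathsf{fix}_nx.M/x]$. **Size order.** $\Gamma\vdash M\leqslant N:A$ is the least family of relations on PCFc terms that is reflexive and transitive; is closed under $M\leqslant N\Rightarrow\mathcal C[M]\leqslant\mathcal C[N]$ for (possibly capturing) monotone contexts $$\mathcal C::=[\,]\mid \mathcal C\mathbin{\mathbf{op}}N\mid M\mathbin{\mathbf{op}}\mathcal C\mid\mathsf{ifz}(\mathcal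 C,P,Q)\mid\langle\mathcal C,N\rangle\mid\langle M,\mathcal C\rangle\mid\pi_i(\mathcal C)\mid\lambda x.\mathcal C\mid\mathcal C\,N\mid\mathcal C\boxplus N\mid M\boxplus\mathcal C ;$$ contains $$\underline{m\mathbin{\mathbf{op}}n}\leqslant\underline m\mathbin{\mathbf{op}}\underline n,\quad P\leqslant\mathsf{ifz}(\underline 0,P,Q),\quad Q\leqslant\mathsf{ifz}(\underline{n+1},P,Q),\quad M_i\leqslant\pi_i\langle M_1,M_2\rangle,\quad M[N/x]\leqslant(\lambda x.M)\,N,$$ $$M\leqslant\mathbf 0\boxplus M,\quad L\boxplus(M\boxplus N)\leqslant(L\boxplus M)\boxplus N,\quad \mathsf{fix}_{n+1}x.M\leqslant\mathsf{fix}_nx.M ;$$ and is closed under the rule: if $M\leqslant\mathcal E[\mathsf{fix}_nx.F]$ for all $n\ge 0$, then $M\leqslant\mathcal E[\mathsf{fix}\,x.F]$, where $\mathcal E::=[\,]\mid\pi_i(\mathcal E)\mid\mathcal E\,M$. **Extraction.** For $E:\mathbb C\times A$ put $E_c=\pi_1(E)$ and $E_p=\pi_2(E)$. Each PCF type $A$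 is sent to a PCFc type $\|A\|$ with a structure map $L+_AE:\|A\|$ (for $L:\mathbb C$, $E:\|A\|$): - $\|\mathsf{nat}\|=\mathbb C\times\mathsf{nat}$, with $L+_{\mathsf{nat}}E=\langle L\boxplus E_c,E_p\rangle$; - $\|A\times B\|=\|A\|\times\|B\|$, with $L+_{A\times B}E=\langle L+_A\pi_1(E),\,L+_B\pi_2(E)\rangle$; - $\|A\to B\|=\|A\|\to\|B\|$, with $L+_{A\to B}E=\lambda x.\,L+_B(E\,x)$ ($x$ fresh). A PCF term $\Gamma\vdash M:A$ is sent to the PCFc term $\|\Gamma\|\vdash\|M\|:\|A\|$ with $$\|x\|=x,\quad \|\underline n\|=\langle\mathbf 0,\underline n\rangle,\quad \|M\mathbin{\mathbf{op}}N\|=\langle\|M\|_c\boxplus\|N\|_c,\ \|M\|_p\mathbin{\mathbf{op}}\|N\|_p\rangle,$$ $$\|\mathsf{ifz}(N,P,Q)\|=\|N\|_c+_A\mathsf{ifz}(\|N\|_p,\|P\|,\|Q\|)\ \ (P,Q:A),\quad \|\langle M,N\rangle\|=\langle\mathbf 1+_A\|M\|,\ \mathbf 1+_B\|N\|\rangle\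 \ (M:A,\ N:B),$$ $$\|\pi_i(M)\|=\pi_i(\|M\|),\quad \|\lambda x.M\|=\lambda x.\,\mathbf 1+_B\|M\|\ \ (M:B),\quad \|M\,N\|=\|M\|\,\|N\|,\quad \|\mathsf{fix}\,x.M\|=\mathsf{fix}\,x.\|M\|.$$ **Theorem (CBN extraction).** There is a family of relations $M\sqsubseteq_AE$, indexed by the PCF types $A$, between closed call-by-name PCF terms $M:A$ and closed PCFc terms $E:\|A\|$, such that 1. if $M\sqsubseteq_{\mathsf{nat}}E$ and $E_c{\downarrow}$, then there are $n,k\in\mathbb N$ with $M\Downarrow^n\underline k$, $\ \underline n^{\mathbb C}\leqslant E_c:\mathbb C$ and $\underline k\leqslant E_p:\mathsf{nat}$; 2. if $M\sqsubseteq_{A_1\times A_2}E$, then $\pi_1(M)\sqsubseteq_{A_1}\pi_1(E)$ and $\pi_2(M)\sqsubseteq_{A_2}\pi_2(E)$; 3. if $M\sqsubseteq_{A\to B}E$, then $M\,N\sqsubseteq_BE\,X$ for all closed $N:A$ and $X:\|A\|$ with $N\sqsubseteq_AX$; 4. $M\sqsubseteq_A\|M\|$ for every closed PCF term $M:A$.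 -/

import Mathlib

/-! Intrinsically typed (de Bruijn) call-by-name PCF, PCF with costs, the size order,
and recurrence extraction. A term of type `Tm Γ A` is a typing derivation `Γ ⊢ M : A`. -/

/-- Typed de Bruijn variables: `Var Γ A` is the type of positions of `A` in `Γ`. -/
inductive Var {T : Type} : List T → T → Type
  | zero {Γ : List T} {A : T} : Var (A :: Γ) A
  | succ {Γ : List T} {A B : T} : Var Γ A → Var (B :: Γ) A

/-- Lifting a map of variables under one binder. -/
def Var.lift {T : Type} {Γ Δ : List T} (ρ : ∀ A, Var Γ A → Var Δ A) (B : T) :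
    ∀ A, Var (B :: Γ) A → Var (B :: Δ) A
  | _, Var.zero => Var.zero
  | _, Var.succ x => Var.succ (ρ _ x)

/-- The variable in position `x` of `Γ` gives the variable in the same position of `Γ.map f`. -/
def Var.map {T U : Type} (f : T → U) : ∀ {Γ : List T} {A : T}, Var Γ A → Var (Γ.map f) (f A)
  | _, _, Var.zero => Var.zero
  | _, _, Var.succ x => Var.succ (Var.map f x)

/-- The five arithmetic operations `+`, `-`, `*`, `÷`, `mod`. -/
inductive ArithOp
  | add | sub | mul | div | mod

/-- The (total) meaning of the operations on natural numbers: truncated subtraction,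
floor division, and both division and remainder by `0` give `0`. -/
def ArithOp.eval : ArithOp → ℕ → ℕ → ℕ
  | add, m, n => m + n
  | sub, m, n => m - n
  | mul, m, n => m * n
  | div, m, n => m / n
  | mod, m, n => if n = 0 then 0 else m % n

/-! ### The source language: call-by-name PCF -/

namespace PCF

inductive Ty
  | nat
  | prod (A B : Ty)
  | arr (A B : Ty)

inductive Tm : List Ty → Ty → Type
  | var {Γ : List Ty} {A : Ty} (x : Var Γ A) : Tm Γ A
  | num {Γ : List Ty} (n : ℕ) : Tm Γ Ty.nat
  | op {Γ : List Ty} (o : ArithOp) (M N : Tm Γ Ty.nat) : Tm Γ Ty.nat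
  /-- `ifz N P Q` behaves like `P` if `N` is `0` and like `Q` otherwise. -/
  | ifz {Γ : List Ty} {A : Ty} (N : Tm Γ Ty.nat) (P Q : Tm Γ A) : Tm Γ A
  | pair {Γ : List Ty} {A B : Ty} (M : Tm Γ A) (N : Tm Γ B) : Tm Γ (Ty.prod A B)
  | fst {Γ : List Ty} {A B : Ty} (M : Tm Γ (Ty.prod A B)) : Tm Γ A
  | snd {Γ : List Ty} {A B : Ty} (M : Tm Γ (Ty.prod A B)) : Tm Γ B
  | lam {Γ : List Ty} {A B : Ty} (M : Tm (A :: Γ) B) : Tm Γ (Ty.arr A B)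
  | app {Γ : List Ty} {A B : Ty} (M : Tm Γ (Ty.arr A B)) (N : Tm Γ A) : Tm Γ B
  | fix {Γ : List Ty} {A : Ty} (M : Tm (A :: Γ) A) : Tm Γ A

namespace Tm

def rename : ∀ {Γ Δ : List Ty} {A : Ty}, (∀ B, Var Γ B → Var Δ B) → Tm Γ A → Tm Δ A
  | _, _, _, ρ, var x => var (ρ _ x)
  | _, _, _, _, num n => num n
  | _, _, _, ρ, op o M N => op o (rename ρ M) (rename ρ N)
  | _, _, _, ρ, ifz N P Q => ifz (rename ρ N) (rename ρ P) (rename ρ Q)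
  | _, _, _, ρ, pair M N => pair (rename ρ M) (rename ρ N)
  | _, _, _, ρ, fst M => fst (rename ρ M)
  | _, _, _, ρ, snd M => snd (rename ρ M)
  | _, _, _, ρ, lam M => lam (rename (Var.lift ρ _) M)
  | _, _, _, ρ, app M N => app (rename ρ M) (rename ρ N)
  | _, _, _, ρ, fix M => fix (rename (Var.lift ρ _) M)

def weaken {Γ : List Ty} {A : Ty} (B : Ty) (M : Tm Γ A) : Tm (B :: Γ) A :=
  rename (fun _ x => Var.succ x) M

def liftSubst {Γ Δ : List Ty} (σ : ∀ A, Var Γ A → Tm Δ A) (B : Ty) :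
    ∀ A, Var (B :: Γ) A → Tm (B :: Δ) A
  | _, Var.zero => var Var.zero
  | _, Var.succ x => weaken B (σ _ x)

/-- Simultaneous capture-avoiding substitution. -/
def subst : ∀ {Γ Δ : List Ty} {A : Ty}, (∀ B, Var Γ B → Tm Δ B) → Tm Γ A → Tm Δ A
  | _, _, _, σ, var x => σ _ x
  | _, _, _, _, num n => num n
  | _, _, _, σ, op o M N => op o (subst σ M) (subst σ N)
  | _, _, _, σ, ifz N P Q => ifz (subst σ N) (subst σ P) (subst σ Q)
  | _, _, _, σ, pair M N => pair (subst σ M) (subst σ N)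
  | _, _, _, σ, fst M => fst (subst σ M)
  | _, _, _, σ, snd M => snd (subst σ M)
  | _, _, _, σ, lam M => lam (subst (liftSubst σ _) M)
  | _, _, _, σ, app M N => app (subst σ M) (subst σ N)
  | _, _, _, σ, fix M => fix (subst (liftSubst σ _) M)

def instSubst {Γ : List Ty} {B : Ty} (N : Tm Γ B) : ∀ A, Var (B :: Γ) A → Tm Γ A
  | _, Var.zero => N
  | _, Var.succ x => var x

/-- `inst M N` is `M[N/x]`, where `x` is the last variable of the context of `M`. -/
def inst {Γ : List Ty} {A B : Ty} (M : Tm (B :: Γ) A) (N : Tm Γ B) : Tm Γ A :=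
  subst (instSubst N) M

end Tm

/-- Call-by-name big-step evaluation with cost: `Eval M V n` is `M ⇓ⁿ V`.
Projections and applications cost one unit each; nothing else does. -/
inductive Eval : ∀ {A : Ty}, Tm [] A → Tm [] A → ℕ → Prop
  | num (k : ℕ) : Eval (Tm.num k) (Tm.num k) 0
  | op (o : ArithOp) {M N : Tm [] Ty.nat} {k l m n : ℕ} :
      Eval M (Tm.num k) m → Eval N (Tm.num l) n →
      Eval (Tm.op o M N) (Tm.num (o.eval k l)) (m + n)
  | ifz_zero {A : Ty} {N : Tm [] Ty.nat} {P Q V : Tm [] A} {m n : ℕ} :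
      Eval N (Tm.num 0) m → Eval P V n → Eval (Tm.ifz N P Q) V (m + n)
  | ifz_succ {A : Ty} {N : Tm [] Ty.nat} {P Q V : Tm [] A} {k m n : ℕ} :
      Eval N (Tm.num (k + 1)) m → Eval Q V n → Eval (Tm.ifz N P Q) V (m + n)
  | pair {A B : Ty} (M : Tm [] A) (N : Tm [] B) : Eval (Tm.pair M N) (Tm.pair M N) 0
  | fst {A B : Ty} {M : Tm [] (Ty.prod A B)} {P : Tm [] A} {Q : Tm [] B} {V : Tm [] A} {m n : ℕ} :
      Eval M (Tm.pair P Q) m → Eval P V n → Eval (Tm.fst M) V (m + n + 1)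
  | snd {A B : Ty} {M : Tm [] (Ty.prod A B)} {P : Tm [] A} {Q : Tm [] B} {V : Tm [] B} {m n : ℕ} :
      Eval M (Tm.pair P Q) m → Eval Q V n → Eval (Tm.snd M) V (m + n + 1)
  | lam {A B : Ty} (M : Tm [A] B) : Eval (Tm.lam M) (Tm.lam M) 0
  | app {A B : Ty} {M : Tm [] (Ty.arr A B)} {N : Tm [] A} {P : Tm [A] B} {V : Tm [] B} {m n : ℕ} :
      Eval M (Tm.lam P) m → Eval (P.inst N) V n → Eval (Tm.app M N) V (m + n + 1)
  | fix {A : Ty} {M : Tm [A] A} {V : Tm [] A} {n : ℕ} :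
      Eval (M.inst (Tm.fix M)) V n → Eval (Tm.fix M) V n

end PCF

/-! ### The recurrence language: PCF with costs -/

namespace PCFc

inductive Ty
  | nat
  | cost
  | prod (A B : Ty)
  | arr (A B : Ty)

inductive Tm : List Ty → Ty → Type
  | var {Γ : List Ty} {A : Ty} (x : Var Γ A) : Tm Γ A
  | num {Γ : List Ty} (n : ℕ) : Tm Γ Ty.nat
  | op {Γ : List Ty} (o : ArithOp) (M N : Tm Γ Ty.nat) : Tm Γ Ty.nat
  | ifz {Γ : List Ty} {A : Ty} (N : Tm Γ Ty.nat) (P Q : Tm Γ A) : Tm Γ A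
  | pair {Γ : List Ty} {A B : Ty} (M : Tm Γ A) (N : Tm Γ B) : Tm Γ (Ty.prod A B)
  | fst {Γ : List Ty} {A B : Ty} (M : Tm Γ (Ty.prod A B)) : Tm Γ A
  | snd {Γ : List Ty} {A B : Ty} (M : Tm Γ (Ty.prod A B)) : Tm Γ B
  | lam {Γ : List Ty} {A B : Ty} (M : Tm (A :: Γ) B) : Tm Γ (Ty.arr A B)
  | app {Γ : List Ty} {A B : Ty} (M : Tm Γ (Ty.arr A B)) (N : Tm Γ A) : Tm Γ B
  | fix {Γ : List Ty} {A : Ty} (M : Tm (A :: Γ) A) : Tm Γ A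
  /-- no cost, written `𝟎` -/
  | czero {Γ : List Ty} : Tm Γ Ty.cost
  /-- unit cost, written `𝟏` -/
  | cone {Γ : List Ty} : Tm Γ Ty.cost
  /-- sum of costs, written `M ⊞ N` -/
  | cplus {Γ : List Ty} (M N : Tm Γ Ty.cost) : Tm Γ Ty.cost

namespace Tm

def rename : ∀ {Γ Δ : List Ty} {A : Ty}, (∀ B, Var Γ B → Var Δ B) → Tm Γ A → Tm Δ A
  | _, _, _, ρ, var x => var (ρ _ x)
  | _, _, _, _, num n => num n
  | _, _, _, ρ, op o M N => op o (rename ρ M) (rename ρ N)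
  | _, _, _, ρ, ifz N P Q => ifz (rename ρ N) (rename ρ P) (rename ρ Q)
  | _, _, _, ρ, pair M N => pair (rename ρ M) (rename ρ N)
  | _, _, _, ρ, fst M => fst (rename ρ M)
  | _, _, _, ρ, snd M => snd (rename ρ M)
  | _, _, _, ρ, lam M => lam (rename (Var.lift ρ _) M)
  | _, _, _, ρ, app M N => app (rename ρ M) (rename ρ N)
  | _, _, _, ρ, fix M => fix (rename (Var.lift ρ _) M)
  | _, _, _, _, czero => czero
  | _, _, _, _, cone => cone
  | _, _, _, ρ, cplus M N => cplus (rename ρ M) (rename ρ N)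

def weaken {Γ : List Ty} {A : Ty} (B : Ty) (M : Tm Γ A) : Tm (B :: Γ) A :=
  rename (fun _ x => Var.succ x) M

def liftSubst {Γ Δ : List Ty} (σ : ∀ A, Var Γ A → Tm Δ A) (B : Ty) :
    ∀ A, Var (B :: Γ) A → Tm (B :: Δ) A
  | _, Var.zero => var Var.zero
  | _, Var.succ x => weaken B (σ _ x)

/-- Simultaneous capture-avoiding substitution. -/
def subst : ∀ {Γ Δ : List Ty} {A : Ty}, (∀ B, Var Γ B → Tm Δ B) → Tm Γ A → Tm Δ A
  | _, _, _, σ, var x => σ _ x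
  | _, _, _, _, num n => num n
  | _, _, _, σ, op o M N => op o (subst σ M) (subst σ N)
  | _, _, _, σ, ifz N P Q => ifz (subst σ N) (subst σ P) (subst σ Q)
  | _, _, _, σ, pair M N => pair (subst σ M) (subst σ N)
  | _, _, _, σ, fst M => fst (subst σ M)
  | _, _, _, σ, snd M => snd (subst σ M)
  | _, _, _, σ, lam M => lam (subst (liftSubst σ _) M)
  | _, _, _, σ, app M N => app (subst σ M) (subst σ N)
  | _, _, _, σ, fix M => fix (subst (liftSubst σ _) M)
  | _, _, _, _, czero => czero
  | _, _, _, _, cone => cone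
  | _, _, _, σ, cplus M N => cplus (subst σ M) (subst σ N)

def instSubst {Γ : List Ty} {B : Ty} (N : Tm Γ B) : ∀ A, Var (B :: Γ) A → Tm Γ A
  | _, Var.zero => N
  | _, Var.succ x => var x

/-- `inst M N` is `M[N/x]`, where `x` is the last variable of the context of `M`. -/
def inst {Γ : List Ty} {A B : Ty} (M : Tm (B :: Γ) A) (N : Tm Γ B) : Tm Γ A :=
  subst (instSubst N) M

/-- The cost numeral of `n`: the right-associated sum `𝟏 ⊞ (… ⊞ (𝟏 ⊞ 𝟎))` with `n` units. -/
def cnum {Γ : List Ty} : ℕ → Tm Γ Ty.cost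
  | 0 => czero
  | n + 1 => cplus cone (cnum n)

/-- The syntactic unfoldings of `fix x. M`: `fixn 0 M = fix x. x` and
`fixn (n + 1) M = M[fixn n M / x]`. -/
def fixn {Γ : List Ty} {A : Ty} : ℕ → Tm (A :: Γ) A → Tm Γ A
  | 0, _ => fix (var Var.zero)
  | n + 1, M => inst M (fixn n M)

end Tm

/-- Big-step evaluation of the recurrence language (call-by-name, no cost annotation). -/
inductive Eval : ∀ {A : Ty}, Tm [] A → Tm [] A → Prop
  | num (k : ℕ) : Eval (Tm.num k) (Tm.num k)
  | op (o : ArithOp) {M N : Tm [] Ty.nat} {k l : ℕ} :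
      Eval M (Tm.num k) → Eval N (Tm.num l) → Eval (Tm.op o M N) (Tm.num (o.eval k l))
  | ifz_zero {A : Ty} {N : Tm [] Ty.nat} {P Q V : Tm [] A} :
      Eval N (Tm.num 0) → Eval P V → Eval (Tm.ifz N P Q) V
  | ifz_succ {A : Ty} {N : Tm [] Ty.nat} {P Q V : Tm [] A} {k : ℕ} :
      Eval N (Tm.num (k + 1)) → Eval Q V → Eval (Tm.ifz N P Q) V
  | pair {A B : Ty} (M : Tm [] A) (N : Tm [] B) : Eval (Tm.pair M N) (Tm.pair M N)
  | fst {A B : Ty} {M : Tm [] (Ty.prod A B)} {P : Tm [] A} {Q : Tm [] B} {V : Tm [] A} :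
      Eval M (Tm.pair P Q) → Eval P V → Eval (Tm.fst M) V
  | snd {A B : Ty} {M : Tm [] (Ty.prod A B)} {P : Tm [] A} {Q : Tm [] B} {V : Tm [] B} :
      Eval M (Tm.pair P Q) → Eval Q V → Eval (Tm.snd M) V
  | lam {A B : Ty} (M : Tm [A] B) : Eval (Tm.lam M) (Tm.lam M)
  | app {A B : Ty} {M : Tm [] (Ty.arr A B)} {N : Tm [] A} {P : Tm [A] B} {V : Tm [] B} :
      Eval M (Tm.lam P) → Eval (P.inst N) V → Eval (Tm.app M N) V
  | fix {A : Ty} {M : Tm [A] A} {V : Tm [] A} :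
      Eval (M.inst (Tm.fix M)) V → Eval (Tm.fix M) V
  | czero : Eval Tm.czero Tm.czero
  | cone : Eval Tm.cone Tm.cone
  | cplus {M N V W : Tm [] Ty.cost} :
      Eval M V → Eval N W → Eval (Tm.cplus M N) (Tm.cplus V W)

/-- `M ↓`: the closed term `M` evaluates to some canonical form. -/
def Bounded {A : Ty} (M : Tm [] A) : Prop := ∃ V, Eval M V

/-- Monotone contexts: `MCtx Γ A Δ B` has a hole for a term `Γ ⊢ M : A` and, once filled,
is a term of type `B` in context `Δ`. -/
inductive MCtx (Γ : List Ty) (A : Ty) : List Ty → Ty → Type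
  | hole : MCtx Γ A Γ A
  | opL {Δ : List Ty} (o : ArithOp) (C : MCtx Γ A Δ Ty.nat) (N : Tm Δ Ty.nat) : MCtx Γ A Δ Ty.nat
  | opR {Δ : List Ty} (o : ArithOp) (M : Tm Δ Ty.nat) (C : MCtx Γ A Δ Ty.nat) : MCtx Γ A Δ Ty.nat
  | ifz {Δ : List Ty} {B : Ty} (C : MCtx Γ A Δ Ty.nat) (P Q : Tm Δ B) : MCtx Γ A Δ B
  | pairL {Δ : List Ty} {B B' : Ty} (C : MCtx Γ A Δ B) (N : Tm Δ B') : MCtx Γ A Δ (Ty.prod B B')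
  | pairR {Δ : List Ty} {B B' : Ty} (M : Tm Δ B) (C : MCtx Γ A Δ B') : MCtx Γ A Δ (Ty.prod B B')
  | fst {Δ : List Ty} {B B' : Ty} (C : MCtx Γ A Δ (Ty.prod B B')) : MCtx Γ A Δ B
  | snd {Δ : List Ty} {B B' : Ty} (C : MCtx Γ A Δ (Ty.prod B B')) : MCtx Γ A Δ B'
  | lam {Δ : List Ty} {B B' : Ty} (C : MCtx Γ A (B :: Δ) B') : MCtx Γ A Δ (Ty.arr B B')
  | app {Δ : List Ty} {B B' : Ty} (C : MCtx Γ A Δ (Ty.arr B B')) (N : Tm Δ B) : MCtx Γ A Δ B'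
  | cplusL {Δ : List Ty} (C : MCtx Γ A Δ Ty.cost) (N : Tm Δ Ty.cost) : MCtx Γ A Δ Ty.cost
  | cplusR {Δ : List Ty} (M : Tm Δ Ty.cost) (C : MCtx Γ A Δ Ty.cost) : MCtx Γ A Δ Ty.cost

/-- Filling the hole (variables of the hole may be captured). -/
def MCtx.fill {Γ : List Ty} {A : Ty} : ∀ {Δ : List Ty} {B : Ty}, MCtx Γ A Δ B → Tm Γ A → Tm Δ B
  | _, _, hole, X => X
  | _, _, opL o C N, X => Tm.op o (C.fill X) N
  | _, _, opR o M C, X => Tm.op o M (C.fill X)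
  | _, _, ifz C P Q, X => Tm.ifz (C.fill X) P Q
  | _, _, pairL C N, X => Tm.pair (C.fill X) N
  | _, _, pairR M C, X => Tm.pair M (C.fill X)
  | _, _, fst C, X => Tm.fst (C.fill X)
  | _, _, snd C, X => Tm.snd (C.fill X)
  | _, _, lam C, X => Tm.lam (C.fill X)
  | _, _, app C N, X => Tm.app (C.fill X) N
  | _, _, cplusL C N, X => Tm.cplus (C.fill X) N
  | _, _, cplusR M C, X => Tm.cplus M (C.fill X)

/-- Eliminative contexts `E ::= [] | π₁ E | π₂ E | E M`. -/
inductive ECtx (Γ : List Ty) (A : Ty) : Ty → Type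
  | hole : ECtx Γ A A
  | fst {B B' : Ty} (E : ECtx Γ A (Ty.prod B B')) : ECtx Γ A B
  | snd {B B' : Ty} (E : ECtx Γ A (Ty.prod B B')) : ECtx Γ A B'
  | app {B B' : Ty} (E : ECtx Γ A (Ty.arr B B')) (M : Tm Γ B) : ECtx Γ A B'

def ECtx.fill {Γ : List Ty} {A : Ty} : ∀ {B : Ty}, ECtx Γ A B → Tm Γ A → Tm Γ B
  | _, hole, X => X
  | _, fst E, X => Tm.fst (E.fill X)
  | _, snd E, X => Tm.snd (E.fill X)
  | _, app E M, X => Tm.app (E.fill X) M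

/-- The size order: `SizeLE M N` is `Γ ⊢ M ≤ N : A`. -/
inductive SizeLE : ∀ {Γ : List Ty} {A : Ty}, Tm Γ A → Tm Γ A → Prop
  | refl {Γ : List Ty} {A : Ty} (M : Tm Γ A) : SizeLE M M
  | trans {Γ : List Ty} {A : Ty} {M N P : Tm Γ A} : SizeLE M N → SizeLE N P → SizeLE M P
  | ctx {Γ Δ : List Ty} {A B : Ty} (C : MCtx Γ A Δ B) {M N : Tm Γ A} :
      SizeLE M N → SizeLE (C.fill M) (C.fill N)
  | op {Γ : List Ty} (o : ArithOp) (m n : ℕ) :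
      SizeLE (Tm.num (o.eval m n) : Tm Γ Ty.nat) (Tm.op o (Tm.num m) (Tm.num n))
  | ifz_zero {Γ : List Ty} {A : Ty} (P Q : Tm Γ A) : SizeLE P (Tm.ifz (Tm.num 0) P Q)
  | ifz_succ {Γ : List Ty} {A : Ty} (n : ℕ) (P Q : Tm Γ A) :
      SizeLE Q (Tm.ifz (Tm.num (n + 1)) P Q)
  | fst {Γ : List Ty} {A B : Ty} (M : Tm Γ A) (N : Tm Γ B) : SizeLE M (Tm.fst (Tm.pair M N))
  | snd {Γ : List Ty} {A B : Ty} (M : Tm Γ A) (N : Tm Γ B) : SizeLE N (Tm.snd (Tm.pair M N))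
  | beta {Γ : List Ty} {A B : Ty} (M : Tm (A :: Γ) B) (N : Tm Γ A) :
      SizeLE (M.inst N) (Tm.app (Tm.lam M) N)
  | zero {Γ : List Ty} (M : Tm Γ Ty.cost) : SizeLE M (Tm.cplus Tm.czero M)
  | assoc {Γ : List Ty} (L M N : Tm Γ Ty.cost) :
      SizeLE (Tm.cplus L (Tm.cplus M N)) (Tm.cplus (Tm.cplus L M) N)
  | rat {Γ : List Ty} {A : Ty} (n : ℕ) (M : Tm (A :: Γ) A) :
      SizeLE (Tm.fixn (n + 1) M) (Tm.fixn n M)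
  | cpind {Γ : List Ty} {A B : Ty} (E : ECtx Γ A B) (F : Tm (A :: Γ) A) {M : Tm Γ B} :
      (∀ n : ℕ, SizeLE M (E.fill (Tm.fixn n F))) → SizeLE M (E.fill (Tm.fix F))

end PCFc

/-! ### Recurrence extraction -/

namespace Extraction

/-- The carrier of the cost algebra `‖A‖`. -/
def ty : PCF.Ty → PCFc.Ty
  | PCF.Ty.nat => PCFc.Ty.prod PCFc.Ty.cost PCFc.Ty.nat
  | PCF.Ty.prod A B => PCFc.Ty.prod (ty A) (ty B)
  | PCF.Ty.arr A B => PCFc.Ty.arr (ty A) (ty B)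

/-- The structure map of the cost algebra `‖A‖`: `charge A L E` is `L +_A E = α_A(L, E)`. -/
def charge : ∀ (A : PCF.Ty) {Γ : List PCFc.Ty},
    PCFc.Tm Γ PCFc.Ty.cost → PCFc.Tm Γ (ty A) → PCFc.Tm Γ (ty A)
  | PCF.Ty.nat, _, L, E => PCFc.Tm.pair (PCFc.Tm.cplus L (PCFc.Tm.fst E)) (PCFc.Tm.snd E)
  | PCF.Ty.prod A B, _, L, E =>
      PCFc.Tm.pair (charge A L (PCFc.Tm.fst E)) (charge B L (PCFc.Tm.snd E))
  | PCF.Ty.arr A B, _, L, E =>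
      PCFc.Tm.lam (charge B (L.weaken (ty A))
        (PCFc.Tm.app (E.weaken (ty A)) (PCFc.Tm.var Var.zero)))

/-- The recurrence `‖M‖` extracted from a term `M`: if `Γ ⊢ M : A` then `‖Γ‖ ⊢ ‖M‖ : ‖A‖`. -/
def tm : ∀ {Γ : List PCF.Ty} {A : PCF.Ty}, PCF.Tm Γ A → PCFc.Tm (Γ.map ty) (ty A)
  | _, _, PCF.Tm.var x => PCFc.Tm.var (Var.map ty x)
  | _, _, PCF.Tm.num n => PCFc.Tm.pair PCFc.Tm.czero (PCFc.Tm.num n)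
  | _, _, PCF.Tm.op o M N =>
      PCFc.Tm.pair (PCFc.Tm.cplus (PCFc.Tm.fst (tm M)) (PCFc.Tm.fst (tm N)))
        (PCFc.Tm.op o (PCFc.Tm.snd (tm M)) (PCFc.Tm.snd (tm N)))
  | _, A, PCF.Tm.ifz N P Q =>
      charge A (PCFc.Tm.fst (tm N)) (PCFc.Tm.ifz (PCFc.Tm.snd (tm N)) (tm P) (tm Q))
  | _, _, PCF.Tm.pair (A := A) (B := B) M N =>
      PCFc.Tm.pair (charge A PCFc.Tm.cone (tm M)) (charge B PCFc.Tm.cone (tm N))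
  | _, _, PCF.Tm.fst M => PCFc.Tm.fst (tm M)
  | _, _, PCF.Tm.snd M => PCFc.Tm.snd (tm M)
  | _, _, PCF.Tm.lam (B := B) M => PCFc.Tm.lam (charge B PCFc.Tm.cone (tm M))
  | _, _, PCF.Tm.app M N => PCFc.Tm.app (tm M) (tm N)
  | _, _, PCF.Tm.fix M => PCFc.Tm.fix (tm M)

end Extraction

/-! The witness is a logical relation `Bounds`, defined by recursion on types, and clause 4 is its
fundamental lemma `Bounds.tm_subst`, proved by induction on terms. Clause 1 alone is too weak as a
definition at `nat`: for `ifz` the inequality k ≤ E_p compares sizes, but does not show that the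
branch selected by k converges when the conditional on E_p does. So at `nat` the relation also asks,
still only when E_c converges, that E_p has no value other than k.

Two closure properties, both by induction on the type, carry the non-recursive cases. On the
recurrence side, E may be replaced by a term that head-reduces to it (`Bounds.above`): sizes only
grow and convergence passes down. On the source side, M may be replaced by a term that takes c more
units, provided the bound is charged some L that covers c (`Bounds.charge_of_bounded`). Extraction
charges a unit where a pair or an abstraction is built, which prepays the later projection or
application.

Fixed points need admissibility (`Bounds.of_fixn`). The 0-th unfolding diverges, so it bounds
everything vacuously, and each further unfolding inherits the bound. To pass to the limit at `nat`,
syntactic compactness (`Apx.exists_eval`) shows that if the cost of the fixed point converges, so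
does that of all late unfoldings. By determinism of the source these all bound the same cost and the
same numeral, so the induction rule `cpind` of the size order applies. -/

/-! ### Substitution calculus for both languages. -/

theorem Var.lift_comp {T : Type} {Γ Δ Θ : List T} (ρ : ∀ A, Var Γ A → Var Δ A)
    (τ : ∀ A, Var Δ A → Var Θ A) (B : T) :
    (fun C x => Var.lift τ B C (Var.lift ρ B C x)) = Var.lift (fun C x => τ C (ρ C x)) B := by
  funext C x
  cases x <;> rfl

namespace PCF.Tm

theorem rename_rename {Γ Δ Θ : List Ty} {A : Ty} (ρ : ∀ B, Var Γ B → Var Δ B)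
    (τ : ∀ B, Var Δ B → Var Θ B) (M : Tm Γ A) :
    rename τ (rename ρ M) = rename (fun B x => τ B (ρ B x)) M := by
  induction M generalizing Δ Θ with
  | lam _ ih | fix _ ih => simp only [rename]; rw [ih, Var.lift_comp]
  | var => rfl
  | _ => simp only [rename, *]

theorem liftSubst_lift {Γ Δ Θ : List Ty} (ρ : ∀ B, Var Γ B → Var Δ B)
    (σ : ∀ B, Var Δ B → Tm Θ B) (B : Ty) :
    (fun C x => liftSubst σ B C (Var.lift ρ B C x)) = liftSubst (fun C x => σ C (ρ C x)) B := by
  funext C x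
  cases x <;> rfl

theorem subst_rename {Γ Δ Θ : List Ty} {A : Ty} (ρ : ∀ B, Var Γ B → Var Δ B)
    (σ : ∀ B, Var Δ B → Tm Θ B) (M : Tm Γ A) :
    subst σ (rename ρ M) = subst (fun B x => σ B (ρ B x)) M := by
  induction M generalizing Δ Θ with
  | lam _ ih | fix _ ih => simp only [rename, subst]; rw [ih, liftSubst_lift]
  | var => rfl
  | _ => simp only [rename, subst, *]

theorem rename_lift_liftSubst {Γ Δ Θ : List Ty} (σ : ∀ B, Var Γ B → Tm Δ B)
    (ρ : ∀ B, Var Δ B → Var Θ B) (B : Ty) :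
    (fun C x => rename (Var.lift ρ B) (liftSubst σ B C x)) =
      liftSubst (fun C x => rename ρ (σ C x)) B := by
  funext C x
  cases x with
  | zero => rfl
  | succ x => simp [liftSubst, weaken, rename_rename, Var.lift]

theorem rename_subst {Γ Δ Θ : List Ty} {A : Ty} (σ : ∀ B, Var Γ B → Tm Δ B)
    (ρ : ∀ B, Var Δ B → Var Θ B) (M : Tm Γ A) :
    rename ρ (subst σ M) = subst (fun B x => rename ρ (σ B x)) M := by
  induction M generalizing Δ Θ with
  | lam _ ih | fix _ ih => simp only [rename, subst]; rw [ih, rename_lift_liftSubst]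
  | var => rfl
  | _ => simp only [rename, subst, *]

theorem subst_liftSubst_weaken {Γ Δ : List Ty} {A : Ty} (σ : ∀ B, Var Γ B → Tm Δ B) (B : Ty)
    (M : Tm Γ A) : subst (liftSubst σ B) (weaken B M) = weaken B (subst σ M) := by
  simp [weaken, subst_rename, rename_subst, liftSubst]

theorem subst_liftSubst {Γ Δ Θ : List Ty} (σ : ∀ B, Var Γ B → Tm Δ B)
    (τ : ∀ B, Var Δ B → Tm Θ B) (B : Ty) :
    (fun C x => subst (liftSubst τ B) (liftSubst σ B C x)) =
      liftSubst (fun C x => subst τ (σ C x)) B := by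
  funext C x
  cases x with
  | zero => rfl
  | succ x => exact subst_liftSubst_weaken τ B (σ C x)

theorem subst_subst {Γ Δ Θ : List Ty} {A : Ty} (σ : ∀ B, Var Γ B → Tm Δ B)
    (τ : ∀ B, Var Δ B → Tm Θ B) (M : Tm Γ A) :
    subst τ (subst σ M) = subst (fun B x => subst τ (σ B x)) M := by
  induction M generalizing Δ Θ with
  | lam _ ih | fix _ ih => simp only [subst]; rw [ih, subst_liftSubst]
  | var => rfl
  | _ => simp only [subst, *]

theorem liftSubst_var {Γ : List Ty} (B : Ty) :
    liftSubst (fun C (x : Var Γ C) => var x) B = fun _ x => var x := by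
  funext C x
  cases x <;> rfl

@[simp]
theorem subst_var {Γ : List Ty} {A : Ty} (M : Tm Γ A) : subst (fun _ x => var x) M = M := by
  induction M with
  | lam _ ih | fix _ ih => simp only [subst]; rw [liftSubst_var, ih]
  | var => rfl
  | _ => simp only [subst, *]

@[simp]
theorem inst_weaken {Γ : List Ty} {A B : Ty} (M : Tm Γ A) (N : Tm Γ B) :
    (weaken B M).inst N = M := by
  simp [inst, weaken, subst_rename, instSubst]

/-- The substitution that sends the last variable to `N` and the others along `σ`. -/
def consSubst {Γ Δ : List Ty} {B : Ty} (N : Tm Δ B) (σ : ∀ A, Var Γ A → Tm Δ A) :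
    ∀ A, Var (B :: Γ) A → Tm Δ A
  | _, Var.zero => N
  | _, Var.succ x => σ _ x

theorem inst_subst_liftSubst {Γ Δ : List Ty} {A B : Ty} (σ : ∀ C, Var Γ C → Tm Δ C)
    (M : Tm (B :: Γ) A) (N : Tm Δ B) :
    (subst (liftSubst σ B) M).inst N = subst (consSubst N σ) M := by
  rw [inst, subst_subst]
  congr 1
  funext C x
  cases x with
  | zero => rfl
  | succ x => exact inst_weaken (σ C x) N

end PCF.Tm

namespace PCFc.Tm

theorem rename_rename {Γ Δ Θ : List Ty} {A : Ty} (ρ : ∀ B, Var Γ B → Var Δ B)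
    (τ : ∀ B, Var Δ B → Var Θ B) (M : Tm Γ A) :
    rename τ (rename ρ M) = rename (fun B x => τ B (ρ B x)) M := by
  induction M generalizing Δ Θ with
  | lam _ ih | fix _ ih => simp only [rename]; rw [ih, Var.lift_comp]
  | var => rfl
  | _ => simp only [rename, *]

theorem liftSubst_lift {Γ Δ Θ : List Ty} (ρ : ∀ B, Var Γ B → Var Δ B)
    (σ : ∀ B, Var Δ B → Tm Θ B) (B : Ty) :
    (fun C x => liftSubst σ B C (Var.lift ρ B C x)) = liftSubst (fun C x => σ C (ρ C x)) B := by
  funext C x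
  cases x <;> rfl

theorem subst_rename {Γ Δ Θ : List Ty} {A : Ty} (ρ : ∀ B, Var Γ B → Var Δ B)
    (σ : ∀ B, Var Δ B → Tm Θ B) (M : Tm Γ A) :
    subst σ (rename ρ M) = subst (fun B x => σ B (ρ B x)) M := by
  induction M generalizing Δ Θ with
  | lam _ ih | fix _ ih => simp only [rename, subst]; rw [ih, liftSubst_lift]
  | var => rfl
  | _ => simp only [rename, subst, *]

theorem rename_lift_liftSubst {Γ Δ Θ : List Ty} (σ : ∀ B, Var Γ B → Tm Δ B)
    (ρ : ∀ B, Var Δ B → Var Θ B) (B : Ty) :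
    (fun C x => rename (Var.lift ρ B) (liftSubst σ B C x)) =
      liftSubst (fun C x => rename ρ (σ C x)) B := by
  funext C x
  cases x with
  | zero => rfl
  | succ x => simp [liftSubst, weaken, rename_rename, Var.lift]

theorem rename_subst {Γ Δ Θ : List Ty} {A : Ty} (σ : ∀ B, Var Γ B → Tm Δ B)
    (ρ : ∀ B, Var Δ B → Var Θ B) (M : Tm Γ A) :
    rename ρ (subst σ M) = subst (fun B x => rename ρ (σ B x)) M := by
  induction M generalizing Δ Θ with
  | lam _ ih | fix _ ih => simp only [rename, subst]; rw [ih, rename_lift_liftSubst]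
  | var => rfl
  | _ => simp only [rename, subst, *]

theorem subst_liftSubst_weaken {Γ Δ : List Ty} {A : Ty} (σ : ∀ B, Var Γ B → Tm Δ B) (B : Ty)
    (M : Tm Γ A) : subst (liftSubst σ B) (weaken B M) = weaken B (subst σ M) := by
  simp [weaken, subst_rename, rename_subst, liftSubst]

theorem subst_liftSubst {Γ Δ Θ : List Ty} (σ : ∀ B, Var Γ B → Tm Δ B)
    (τ : ∀ B, Var Δ B → Tm Θ B) (B : Ty) :
    (fun C x => subst (liftSubst τ B) (liftSubst σ B C x)) =
      liftSubst (fun C x => subst τ (σ C x)) B := by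
  funext C x
  cases x with
  | zero => rfl
  | succ x => exact subst_liftSubst_weaken τ B (σ C x)

theorem subst_subst {Γ Δ Θ : List Ty} {A : Ty} (σ : ∀ B, Var Γ B → Tm Δ B)
    (τ : ∀ B, Var Δ B → Tm Θ B) (M : Tm Γ A) :
    subst τ (subst σ M) = subst (fun B x => subst τ (σ B x)) M := by
  induction M generalizing Δ Θ with
  | lam _ ih | fix _ ih => simp only [subst]; rw [ih, subst_liftSubst]
  | var => rfl
  | _ => simp only [subst, *]

theorem liftSubst_var {Γ : List Ty} (B : Ty) :
    liftSubst (fun C (x : Var Γ C) => var x) B = fun _ x => var x := by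
  funext C x
  cases x <;> rfl

@[simp]
theorem subst_var {Γ : List Ty} {A : Ty} (M : Tm Γ A) : subst (fun _ x => var x) M = M := by
  induction M with
  | lam _ ih | fix _ ih => simp only [subst]; rw [liftSubst_var, ih]
  | var => rfl
  | _ => simp only [subst, *]

theorem subst_closed {A : Ty} (σ : ∀ B, Var [] B → Tm [] B) (M : Tm [] A) : subst σ M = M := by
  obtain rfl : σ = fun _ x => var x := funext fun _ => funext fun x => nomatch x
  exact subst_var M

@[simp]
theorem inst_weaken {Γ : List Ty} {A B : Ty} (M : Tm Γ A) (N : Tm Γ B) :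
    (weaken B M).inst N = M := by
  simp [inst, weaken, subst_rename, instSubst]

/-- The substitution that sends the last variable to `N` and the others along `σ`. -/
def consSubst {Γ Δ : List Ty} {B : Ty} (N : Tm Δ B) (σ : ∀ A, Var Γ A → Tm Δ A) :
    ∀ A, Var (B :: Γ) A → Tm Δ A
  | _, Var.zero => N
  | _, Var.succ x => σ _ x

theorem inst_subst_liftSubst {Γ Δ : List Ty} {A B : Ty} (σ : ∀ C, Var Γ C → Tm Δ C)
    (M : Tm (B :: Γ) A) (N : Tm Δ B) :
    (subst (liftSubst σ B) M).inst N = subst (consSubst N σ) M := by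
  rw [inst, subst_subst]
  congr 1
  funext C x
  cases x with
  | zero => rfl
  | succ x => exact inst_weaken (σ C x) N

theorem rename_closed {A : Ty} (ρ : ∀ B, Var [] B → Var [] B) (M : Tm [] A) : rename ρ M = M := by
  have h := subst_rename ρ (fun _ x => var x) M
  rwa [subst_var, subst_closed] at h

/-- A closed term has no variable to act on, so all ways of moving it into `Δ` agree. This keeps
copies of `fix x. F` lying under binders recognizable after substitution. -/
theorem subst_rename_closed {Γ Δ : List Ty} {A : Ty} (τ : ∀ B, Var [] B → Var Γ B)
    (σ : ∀ B, Var Γ B → Tm Δ B) (ρ : ∀ B, Var [] B → Var Δ B) (M : Tm [] A) :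
    subst σ (rename τ M) = rename ρ M := by
  have h := subst_rename ρ (fun _ x => var x) M
  rw [subst_var] at h
  rw [subst_rename, h]
  congr 1
  funext B x
  nomatch x

end PCFc.Tm

/-! ### Syntactic compactness of evaluation. -/

namespace PCFc

open Tm

/-- `Apx F n M N`: the term `M` is obtained from `N` by replacing some occurrences of the closed
term `fix x. F` by unfoldings `fixn m F` with `n ≤ m`. -/
inductive Apx {A₀ : Ty} (F : Tm [A₀] A₀) (n : ℕ) : ∀ {Γ : List Ty} {A : Ty}, Tm Γ A → Tm Γ A → Prop
  | unfold {Γ : List Ty} {M N : Tm Γ A₀} (ρ : ∀ B, Var [] B → Var Γ B) (m : ℕ) (h : n ≤ m)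
      (hM : M = rename ρ (fixn m F)) (hN : N = rename ρ (Tm.fix F)) : Apx F n M N
  | var {Γ : List Ty} {A : Ty} (x : Var Γ A) : Apx F n (Tm.var x) (Tm.var x)
  | num {Γ : List Ty} (k : ℕ) : Apx F n (Tm.num k : Tm Γ _) (Tm.num k)
  | op {Γ : List Ty} (o : ArithOp) {M M' N N' : Tm Γ Ty.nat} :
      Apx F n M M' → Apx F n N N' → Apx F n (Tm.op o M N) (Tm.op o M' N')
  | ifz {Γ : List Ty} {A : Ty} {N N' : Tm Γ Ty.nat} {P P' Q Q' : Tm Γ A} :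
      Apx F n N N' → Apx F n P P' → Apx F n Q Q' → Apx F n (Tm.ifz N P Q) (Tm.ifz N' P' Q')
  | pair {Γ : List Ty} {A B : Ty} {M M' : Tm Γ A} {N N' : Tm Γ B} :
      Apx F n M M' → Apx F n N N' → Apx F n (Tm.pair M N) (Tm.pair M' N')
  | fst {Γ : List Ty} {A B : Ty} {M M' : Tm Γ (Ty.prod A B)} :
      Apx F n M M' → Apx F n (Tm.fst M) (Tm.fst M')
  | snd {Γ : List Ty} {A B : Ty} {M M' : Tm Γ (Ty.prod A B)} :
      Apx F n M M' → Apx F n (Tm.snd M) (Tm.snd M')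
  | lam {Γ : List Ty} {A B : Ty} {M M' : Tm (A :: Γ) B} :
      Apx F n M M' → Apx F n (Tm.lam M) (Tm.lam M')
  | app {Γ : List Ty} {A B : Ty} {M M' : Tm Γ (Ty.arr A B)} {N N' : Tm Γ A} :
      Apx F n M M' → Apx F n N N' → Apx F n (Tm.app M N) (Tm.app M' N')
  | fix {Γ : List Ty} {A : Ty} {M M' : Tm (A :: Γ) A} :
      Apx F n M M' → Apx F n (Tm.fix M) (Tm.fix M')
  | czero {Γ : List Ty} : Apx F n (Tm.czero : Tm Γ _) Tm.czero
  | cone {Γ : List Ty} : Apx F n (Tm.cone : Tm Γ _) Tm.cone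
  | cplus {Γ : List Ty} {M M' N N' : Tm Γ Ty.cost} :
      Apx F n M M' → Apx F n N N' → Apx F n (Tm.cplus M N) (Tm.cplus M' N')

namespace Apx

variable {A₀ : Ty} {F : Tm [A₀] A₀} {n : ℕ}

theorem refl {Γ : List Ty} {A : Ty} (M : Tm Γ A) : Apx F n M M := by
  induction M <;> constructor <;> assumption

theorem mono {m : ℕ} (hmn : m ≤ n) {Γ : List Ty} {A : Ty} {M N : Tm Γ A} (h : Apx F n M N) :
    Apx F m M N := by
  induction h with
  | unfold ρ k hk hM hN => exact .unfold ρ k (hmn.trans hk) hM hN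
  | _ => constructor <;> assumption

theorem rename {Γ Δ : List Ty} {A : Ty} {M N : Tm Γ A} (ρ : ∀ B, Var Γ B → Var Δ B)
    (h : Apx F n M N) : Apx F n (Tm.rename ρ M) (Tm.rename ρ N) := by
  induction h generalizing Δ with
  | unfold τ k hk hM hN =>
    subst hM hN
    exact .unfold (fun B x => ρ B (τ B x)) k hk (rename_rename ..) (rename_rename ..)
  | _ => constructor <;> apply_assumption

theorem liftSubst {Γ Δ : List Ty} {σ σ' : ∀ B, Var Γ B → Tm Δ B}
    (hσ : ∀ B x, Apx F n (σ B x) (σ' B x)) (C : Ty) :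
    ∀ B x, Apx F n (Tm.liftSubst σ C B x) (Tm.liftSubst σ' C B x)
  | _, .zero => .var _
  | _, .succ x => (hσ _ x).rename _

theorem subst {Γ Δ : List Ty} {A : Ty} {M N : Tm Γ A} {σ σ' : ∀ B, Var Γ B → Tm Δ B}
    (h : Apx F n M N) (hσ : ∀ B x, Apx F n (σ B x) (σ' B x)) :
    Apx F n (Tm.subst σ M) (Tm.subst σ' N) := by
  induction h generalizing Δ with
  | unfold τ k hk hM hN =>
    subst hM hN
    exact .unfold (fun _ x => nomatch x) k hk (subst_rename_closed ..) (subst_rename_closed ..)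
  | var x => exact hσ _ x
  | lam _ ih => exact .lam (ih (liftSubst hσ _))
  | fix _ ih => exact .fix (ih (liftSubst hσ _))
  | _ => constructor <;> apply_assumption <;> assumption

theorem inst {Γ : List Ty} {A B : Ty} {M M' : Tm (B :: Γ) A} {N N' : Tm Γ B}
    (h : Apx F n M M') (h' : Apx F n N N') : Apx F n (M.inst N) (M'.inst N') := by
  refine h.subst fun C x => ?_
  cases x with
  | zero => exact h'
  | succ x => exact .var x

/-- A renamed `fix` is never a numeral, so `unfold` cannot apply. This and its analogues for pairs
and abstractions show that an approximant of such a value has the same shape. -/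
theorem num_inv {Γ : List Ty} {M : Tm Γ Ty.nat} {k : ℕ} (h : Apx F n M (Tm.num k)) :
    M = Tm.num k := by
  cases h with
  | unfold ρ m h hM hN => simp [Tm.rename] at hN
  | num => rfl

theorem pair_inv {Γ : List Ty} {A B : Ty} {M : Tm Γ (Ty.prod A B)} {P : Tm Γ A} {Q : Tm Γ B}
    (h : Apx F n M (Tm.pair P Q)) :
    ∃ P' Q', M = Tm.pair P' Q' ∧ Apx F n P' P ∧ Apx F n Q' Q := by
  cases h with
  | unfold ρ m h hM hN => simp [Tm.rename] at hN
  | pair h h' => exact ⟨_, _, rfl, h, h'⟩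

theorem lam_inv {Γ : List Ty} {A B : Ty} {M : Tm Γ (Ty.arr A B)} {P : Tm (A :: Γ) B}
    (h : Apx F n M (Tm.lam P)) : ∃ P', M = Tm.lam P' ∧ Apx F n P' P := by
  cases h with
  | unfold ρ m h hM hN => simp [Tm.rename] at hN
  | lam h => exact ⟨_, rfl, h⟩

/-- Syntactic compactness: evaluation uses only finitely many unfoldings of `fix x. F`. -/
theorem exists_eval (F : Tm [A₀] A₀) {A : Ty} {N V : Tm [] A} (h : Eval N V) :
    ∃ k, ∀ n M, Apx F (n + k) M N → ∃ V', Eval M V' ∧ Apx F n V' V := by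
  induction h with
  | num k =>
    refine ⟨0, fun n M h => ?_⟩
    rw [h.num_inv]
    exact ⟨_, .num k, .num k⟩
  | op o _ _ ih₁ ih₂ =>
    obtain ⟨k₁, ih₁⟩ := ih₁
    obtain ⟨k₂, ih₂⟩ := ih₂
    refine ⟨k₁ + k₂, fun n M h => ?_⟩
    cases h with
    | unfold ρ m h hM hN => simp [Tm.rename] at hN
    | op _ h₁ h₂ =>
      obtain ⟨V₁, e₁, a₁⟩ := ih₁ n _ (h₁.mono (by omega))
      obtain ⟨V₂, e₂, a₂⟩ := ih₂ n _ (h₂.mono (by omega))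
      rw [a₁.num_inv] at e₁
      rw [a₂.num_inv] at e₂
      exact ⟨_, .op o e₁ e₂, .num _⟩
  | ifz_zero _ _ ih₁ ih₂ =>
    obtain ⟨k₁, ih₁⟩ := ih₁
    obtain ⟨k₂, ih₂⟩ := ih₂
    refine ⟨k₁ + k₂, fun n M h => ?_⟩
    cases h with
    | unfold ρ m h hM hN => simp [Tm.rename] at hN
    | ifz h₁ h₂ _ =>
      obtain ⟨V₁, e₁, a₁⟩ := ih₁ n _ (h₁.mono (by omega))
      obtain ⟨V₂, e₂, a₂⟩ := ih₂ n _ (h₂.mono (by omega))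
      rw [a₁.num_inv] at e₁
      exact ⟨_, .ifz_zero e₁ e₂, a₂⟩
  | ifz_succ _ _ ih₁ ih₂ =>
    obtain ⟨k₁, ih₁⟩ := ih₁
    obtain ⟨k₂, ih₂⟩ := ih₂
    refine ⟨k₁ + k₂, fun n M h => ?_⟩
    cases h with
    | unfold ρ m h hM hN => simp [Tm.rename] at hN
    | ifz h₁ _ h₂ =>
      obtain ⟨V₁, e₁, a₁⟩ := ih₁ n _ (h₁.mono (by omega))
      obtain ⟨V₂, e₂, a₂⟩ := ih₂ n _ (h₂.mono (by omega))
      rw [a₁.num_inv] at e₁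
      exact ⟨_, .ifz_succ e₁ e₂, a₂⟩
  | pair P Q =>
    refine ⟨0, fun n M h => ?_⟩
    obtain ⟨P', Q', rfl, h₁, h₂⟩ := h.pair_inv
    exact ⟨_, .pair P' Q', .pair h₁ h₂⟩
  | fst _ _ ih₁ ih₂ =>
    obtain ⟨k₁, ih₁⟩ := ih₁
    obtain ⟨k₂, ih₂⟩ := ih₂
    refine ⟨k₁ + k₂, fun n M h => ?_⟩
    cases h with
    | unfold ρ m h hM hN => simp [Tm.rename] at hN
    | fst h =>
      -- A component of the resulting pair is still to be evaluated, so the first evaluation must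
      -- leave `k₂` unfoldings in reserve.
      obtain ⟨V₁, e₁, a₁⟩ := ih₁ (n + k₂) _ (h.mono (by omega))
      obtain ⟨P', Q', rfl, h₁, h₂⟩ := a₁.pair_inv
      obtain ⟨V₂, e₂, a₂⟩ := ih₂ n _ h₁
      exact ⟨_, .fst e₁ e₂, a₂⟩
  | snd _ _ ih₁ ih₂ =>
    obtain ⟨k₁, ih₁⟩ := ih₁
    obtain ⟨k₂, ih₂⟩ := ih₂
    refine ⟨k₁ + k₂, fun n M h => ?_⟩
    cases h with
    | unfold ρ m h hM hN => simp [Tm.rename] at hN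
    | snd h =>
      obtain ⟨V₁, e₁, a₁⟩ := ih₁ (n + k₂) _ (h.mono (by omega))
      obtain ⟨P', Q', rfl, h₁, h₂⟩ := a₁.pair_inv
      obtain ⟨V₂, e₂, a₂⟩ := ih₂ n _ h₂
      exact ⟨_, .snd e₁ e₂, a₂⟩
  | lam P =>
    refine ⟨0, fun n M h => ?_⟩
    obtain ⟨P', rfl, h'⟩ := h.lam_inv
    exact ⟨_, .lam P', .lam h'⟩
  | app _ _ ih₁ ih₂ =>
    obtain ⟨k₁, ih₁⟩ := ih₁
    obtain ⟨k₂, ih₂⟩ := ih₂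
    refine ⟨k₁ + k₂, fun n M h => ?_⟩
    cases h with
    | unfold ρ m h hM hN => simp [Tm.rename] at hN
    | app h h' =>
      obtain ⟨V₁, e₁, a₁⟩ := ih₁ (n + k₂) _ (h.mono (by omega))
      obtain ⟨P', rfl, h₁⟩ := a₁.lam_inv
      obtain ⟨V₂, e₂, a₂⟩ := ih₂ n _ (h₁.inst (h'.mono (by omega)))
      exact ⟨_, .app e₁ e₂, a₂⟩
  | fix _ ih =>
    obtain ⟨k, ih⟩ := ih
    -- The extra unit ensures that a replaced `fix x. F` is a positive unfolding, from which one
    -- layer can be peeled.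
    refine ⟨k + 1, fun n M h => ?_⟩
    cases h with
    | unfold ρ m h hM hN =>
      rw [rename_closed] at hM hN
      cases hN
      obtain ⟨m, rfl⟩ : ∃ m', m = m' + 1 := ⟨m - 1, by omega⟩
      subst hM
      refine ih n _ ((refl F).inst (.unfold (fun _ x => x) m (by omega) ?_ ?_)) <;>
        rw [rename_closed]
    | fix h =>
      have h' := h.mono (m := n + k) (by omega)
      obtain ⟨V', e, a⟩ := ih n _ (h'.inst h'.fix)
      exact ⟨V', .fix e, a⟩
  | czero =>
    refine ⟨0, fun n M h => ?_⟩
    cases h with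
    | unfold ρ m h hM hN => simp [Tm.rename] at hN
    | czero => exact ⟨_, .czero, .czero⟩
  | cone =>
    refine ⟨0, fun n M h => ?_⟩
    cases h with
    | unfold ρ m h hM hN => simp [Tm.rename] at hN
    | cone => exact ⟨_, .cone, .cone⟩
  | cplus _ _ ih₁ ih₂ =>
    obtain ⟨k₁, ih₁⟩ := ih₁
    obtain ⟨k₂, ih₂⟩ := ih₂
    refine ⟨k₁ + k₂, fun n M h => ?_⟩
    cases h with
    | unfold ρ m h hM hN => simp [Tm.rename] at hN
    | cplus h₁ h₂ =>
      obtain ⟨V₁, e₁, a₁⟩ := ih₁ n _ (h₁.mono (by omega))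
      obtain ⟨V₂, e₂, a₂⟩ := ih₂ n _ (h₂.mono (by omega))
      exact ⟨_, .cplus e₁ e₂, .cplus a₁ a₂⟩

theorem ecFill {A : Ty} (E : ECtx [] A₀ A) {m : ℕ} (h : n ≤ m) :
    Apx F n (E.fill (fixn m F)) (E.fill (Tm.fix F)) := by
  induction E with
  | hole => exact .unfold (fun _ x => x) m h (rename_closed ..).symm (rename_closed ..).symm
  | fst _ ih => exact .fst ih
  | snd _ ih => exact .snd ih
  | app _ M ih => exact .app ih (refl M)

end Apx

end PCFc

/-! ### Determinism and cost expansion in the source language. -/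

namespace PCF

/-- Needed for admissibility: the cost and the numeral supplied by different unfoldings of a fixed
point must coincide. -/
theorem Eval.det {A : Ty} {M V W : Tm [] A} {m n : ℕ} (h : Eval M V m) (h' : Eval M W n) :
    V = W ∧ m = n := by
  induction h generalizing n with
  | num | pair | lam => cases h'; exact ⟨rfl, rfl⟩
  | op o _ _ ih₁ ih₂ =>
    cases h' with
    | op _ h₁ h₂ =>
      obtain ⟨e₁, rfl⟩ := ih₁ h₁
      obtain ⟨e₂, rfl⟩ := ih₂ h₂
      cases e₁
      cases e₂
      exact ⟨rfl, rfl⟩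
  | ifz_zero _ _ ih₁ ih₂ =>
    cases h' with
    | ifz_zero h₁ h₂ =>
      obtain ⟨-, rfl⟩ := ih₁ h₁
      obtain ⟨rfl, rfl⟩ := ih₂ h₂
      exact ⟨rfl, rfl⟩
    | ifz_succ h₁ h₂ => exact absurd (ih₁ h₁).1 (by simp)
  | ifz_succ _ _ ih₁ ih₂ =>
    cases h' with
    | ifz_zero h₁ h₂ => exact absurd (ih₁ h₁).1 (by simp)
    | ifz_succ h₁ h₂ =>
      obtain ⟨-, rfl⟩ := ih₁ h₁
      obtain ⟨rfl, rfl⟩ := ih₂ h₂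
      exact ⟨rfl, rfl⟩
  | fst _ _ ih₁ ih₂ =>
    cases h' with
    | fst h₁ h₂ =>
      obtain ⟨e₁, rfl⟩ := ih₁ h₁
      cases e₁
      obtain ⟨rfl, rfl⟩ := ih₂ h₂
      exact ⟨rfl, rfl⟩
  | snd _ _ ih₁ ih₂ =>
    cases h' with
    | snd h₁ h₂ =>
      obtain ⟨e₁, rfl⟩ := ih₁ h₁
      cases e₁
      obtain ⟨rfl, rfl⟩ := ih₂ h₂
      exact ⟨rfl, rfl⟩
  | app _ _ ih₁ ih₂ =>
    cases h' with
    | app h₁ h₂ =>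
      obtain ⟨e₁, rfl⟩ := ih₁ h₁
      cases e₁
      obtain ⟨rfl, rfl⟩ := ih₂ h₂
      exact ⟨rfl, rfl⟩
  | fix _ ih =>
    cases h' with
    | fix h => exact ih h

/-- Evaluation of `M` costs `c` more than evaluation of `M'`, with the same result. -/
def Expands (c : ℕ) {A : Ty} (M M' : Tm [] A) : Prop :=
  ∀ V n, Eval M' V n → Eval M V (c + n)

namespace Expands

variable {A B : Ty} {c : ℕ}

theorem fst {M M' : Tm [] (Ty.prod A B)} (h : Expands c M M') :
    Expands c (Tm.fst M) (Tm.fst M') := by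
  intro V n e
  cases e with
  | fst e₁ e₂ => simpa only [add_assoc] using (h _ _ e₁).fst e₂

theorem snd {M M' : Tm [] (Ty.prod A B)} (h : Expands c M M') :
    Expands c (Tm.snd M) (Tm.snd M') := by
  intro V n e
  cases e with
  | snd e₁ e₂ => simpa only [add_assoc] using (h _ _ e₁).snd e₂

theorem app {M M' : Tm [] (Ty.arr A B)} (h : Expands c M M') (N : Tm [] A) :
    Expands c (Tm.app M N) (Tm.app M' N) := by
  intro V n e
  cases e with
  | app e₁ e₂ => simpa only [add_assoc] using (h _ _ e₁).app e₂

theorem fst_pair (M : Tm [] A) (N : Tm [] B) : Expands 1 (Tm.fst (Tm.pair M N)) M :=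
  fun _ n e => by simpa only [zero_add, add_comm 1 n] using (Eval.pair M N).fst e

theorem snd_pair (M : Tm [] A) (N : Tm [] B) : Expands 1 (Tm.snd (Tm.pair M N)) N :=
  fun _ n e => by simpa only [zero_add, add_comm 1 n] using (Eval.pair M N).snd e

theorem beta (M : Tm [A] B) (N : Tm [] A) : Expands 1 (Tm.app (Tm.lam M) N) (M.inst N) :=
  fun _ n e => by simpa only [zero_add, add_comm 1 n] using (Eval.lam M).app e

theorem fix (M : Tm [A] A) : Expands 0 (Tm.fix M) (M.inst (Tm.fix M)) :=
  fun _ n e => by simpa only [zero_add] using e.fix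

end Expands

end PCF

/-! ### Size order, head expansion and divergence in the recurrence language. -/

namespace PCFc

namespace SizeLE

variable {Γ : List Ty} {A B : Ty}

theorem congr_fst {M N : Tm Γ (Ty.prod A B)} (h : SizeLE M N) : SizeLE (Tm.fst M) (Tm.fst N) :=
  h.ctx (.fst .hole)

theorem congr_snd {M N : Tm Γ (Ty.prod A B)} (h : SizeLE M N) : SizeLE (Tm.snd M) (Tm.snd N) :=
  h.ctx (.snd .hole)

theorem congr_app {M N : Tm Γ (Ty.arr A B)} (h : SizeLE M N) (X : Tm Γ A) :
    SizeLE (Tm.app M X) (Tm.app N X) :=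
  h.ctx (.app .hole X)

theorem congr_ifz {M N : Tm Γ Ty.nat} (h : SizeLE M N) (P Q : Tm Γ A) :
    SizeLE (Tm.ifz M P Q) (Tm.ifz N P Q) :=
  h.ctx (.ifz .hole P Q)

theorem congr_op (o : ArithOp) {M M' N N' : Tm Γ Ty.nat} (h : SizeLE M M') (h' : SizeLE N N') :
    SizeLE (Tm.op o M N) (Tm.op o M' N') :=
  (h.ctx (.opL o .hole N)).trans (h'.ctx (.opR o M' .hole))

theorem congr_cplus {M M' N N' : Tm Γ Ty.cost} (h : SizeLE M M') (h' : SizeLE N N') :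
    SizeLE (Tm.cplus M N) (Tm.cplus M' N') :=
  (h.ctx (.cplusL .hole N)).trans (h'.ctx (.cplusR M' .hole))

theorem congr_eCtx {M N : Tm Γ A} (h : SizeLE M N) (E : ECtx Γ A B) :
    SizeLE (E.fill M) (E.fill N) := by
  induction E with
  | hole => exact h
  | fst _ ih => exact ih.congr_fst
  | snd _ ih => exact ih.congr_snd
  | app _ X ih => exact ih.congr_app X

/-- Cost numerals are nested to the right, so the directed axioms `zero` and `assoc` are exactly
what re-brackets the sum. -/
theorem cnum_add (m n : ℕ) :
    SizeLE (Tm.cnum (m + n) : Tm Γ Ty.cost) (Tm.cplus (Tm.cnum m) (Tm.cnum n)) := by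
  induction m with
  | zero => rw [Nat.zero_add]; exact .zero _
  | succ m ih => rw [Nat.succ_add]; exact (congr_cplus (.refl _) ih).trans (.assoc ..)

theorem fixn_antitone {M : Tm (A :: Γ) A} {m n : ℕ} (h : m ≤ n) :
    SizeLE (Tm.fixn n M) (Tm.fixn m M) := by
  induction h with
  | refl => exact .refl _
  | step _ ih => exact (SizeLE.rat _ M).trans ih

end SizeLE

theorem Bounded.of_cplus {M N : Tm [] Ty.cost} (h : Bounded (Tm.cplus M N)) :
    Bounded M ∧ Bounded N := by
  obtain ⟨V, e⟩ := h
  cases e with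
  | cplus e₁ e₂ => exact ⟨⟨_, e₁⟩, ⟨_, e₂⟩⟩

/-- `E` is above `E'` in the size order, and every value of `E` is a value of `E'`. -/
def Above {A : Ty} (E E' : Tm [] A) : Prop :=
  SizeLE E' E ∧ ∀ V, Eval E V → Eval E' V

namespace Above

variable {A B : Ty}

theorem fst {E E' : Tm [] (Ty.prod A B)} (h : Above E E') : Above (Tm.fst E) (Tm.fst E') := by
  refine ⟨h.1.congr_fst, fun V e => ?_⟩
  cases e with
  | fst e₁ e₂ => exact (h.2 _ e₁).fst e₂

theorem snd {E E' : Tm [] (Ty.prod A B)} (h : Above E E') : Above (Tm.snd E) (Tm.snd E') := by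
  refine ⟨h.1.congr_snd, fun V e => ?_⟩
  cases e with
  | snd e₁ e₂ => exact (h.2 _ e₁).snd e₂

theorem app {E E' : Tm [] (Ty.arr A B)} (h : Above E E') (X : Tm [] A) :
    Above (Tm.app E X) (Tm.app E' X) := by
  refine ⟨h.1.congr_app X, fun V e => ?_⟩
  cases e with
  | app e₁ e₂ => exact (h.2 _ e₁).app e₂

theorem bounded {E E' : Tm [] A} (h : Above E E') : Bounded E → Bounded E' :=
  fun ⟨V, e⟩ => ⟨V, h.2 V e⟩

theorem fst_pair (M : Tm [] A) (N : Tm [] B) : Above (Tm.fst (Tm.pair M N)) M := by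
  refine ⟨.fst M N, fun V e => ?_⟩
  cases e with
  | fst e₁ e₂ => cases e₁; exact e₂

theorem snd_pair (M : Tm [] A) (N : Tm [] B) : Above (Tm.snd (Tm.pair M N)) N := by
  refine ⟨.snd M N, fun V e => ?_⟩
  cases e with
  | snd e₁ e₂ => cases e₁; exact e₂

theorem beta (M : Tm [A] B) (N : Tm [] A) : Above (Tm.app (Tm.lam M) N) (M.inst N) := by
  refine ⟨.beta M N, fun V e => ?_⟩
  cases e with
  | app e₁ e₂ => cases e₁; exact e₂

/-- The inequality on `N` gives the size half only; the hypothesis on values rules out the other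
branch, so that values of the conditional are values of `P`. -/
theorem ifz_zero {N : Tm [] Ty.nat} (P Q : Tm [] A) (hN : SizeLE (Tm.num 0) N)
    (h : ∀ V, Eval N V → V = Tm.num 0) : Above (Tm.ifz N P Q) P := by
  refine ⟨(SizeLE.ifz_zero P Q).trans (hN.congr_ifz P Q), fun V e => ?_⟩
  cases e with
  | ifz_zero _ e => exact e
  | ifz_succ e _ => exact absurd (h _ e) (by simp)

theorem ifz_succ {N : Tm [] Ty.nat} {k : ℕ} (P Q : Tm [] A) (hN : SizeLE (Tm.num (k + 1)) N)
    (h : ∀ V, Eval N V → V = Tm.num (k + 1)) : Above (Tm.ifz N P Q) Q := by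
  refine ⟨(SizeLE.ifz_succ k P Q).trans (hN.congr_ifz P Q), fun V e => ?_⟩
  cases e with
  | ifz_zero e _ => exact absurd (h _ e) (by simp)
  | ifz_succ _ e => exact e

end Above

theorem Eval.ne_fix {A : Ty} {M V : Tm [] A} (h : Eval M V) (F : Tm [A] A) : V ≠ Tm.fix F := by
  induction h with
  | _ => simp_all

theorem not_bounded_fixn_zero {A : Ty} (F : Tm [A] A) : ¬ Bounded (Tm.fixn 0 F) := by
  -- Evaluating `fix x. x` has as its only premise an evaluation of the same term. Stating this for
  -- arbitrary `M` makes induction on the derivation available.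
  suffices ∀ {B : Ty} {M V : Tm [] B}, Eval M V → M ≠ Tm.fix (Tm.var Var.zero) from
    fun ⟨V, e⟩ => this e rfl
  intro B M V e
  induction e with
  | fix _ ih => rintro ⟨⟩; exact ih rfl
  | _ => simp

theorem not_bounded_eCtx {A B : Ty} {M : Tm [] A} (h : ¬ Bounded M) (E : ECtx [] A B) :
    ¬ Bounded (E.fill M) := by
  induction E with
  | hole => exact h
  | fst _ ih => rintro ⟨V, e⟩; cases e with | fst e _ => exact ih ⟨_, e⟩
  | snd _ ih => rintro ⟨V, e⟩; cases e with | snd e _ => exact ih ⟨_, e⟩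
  | app _ X ih => rintro ⟨V, e⟩; cases e with | app e _ => exact ih ⟨_, e⟩

end PCFc

/-! ### The logical relation and its fundamental lemma. -/

namespace Extraction

open PCFc (Above Bounded ECtx SizeLE)

/-- `charge` is a recursive operation on terms rather than a constructor, so its compatibility with
substitution must be proved by induction on the type. -/
theorem charge_subst (A : PCF.Ty) {Γ Δ : List PCFc.Ty} (σ : ∀ B, Var Γ B → PCFc.Tm Δ B)
    (L : PCFc.Tm Γ PCFc.Ty.cost) (E : PCFc.Tm Γ (ty A)) :
    (charge A L E).subst σ = charge A (L.subst σ) (E.subst σ) := by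
  induction A generalizing Γ Δ with
  | nat => rfl
  | prod A B ihA ihB =>
    simp only [charge, PCFc.Tm.subst]
    rw [ihA, ihB]
    rfl
  | arr A B _ ih =>
    simp only [charge, PCFc.Tm.subst]
    rw [ih, PCFc.Tm.subst_liftSubst_weaken]
    exact congrArg (fun X : PCFc.Tm (ty A :: Δ) (PCFc.Ty.arr (ty A) (ty B)) =>
      PCFc.Tm.lam (charge B ((L.subst σ).weaken (ty A))
        (PCFc.Tm.app X (PCFc.Tm.var Var.zero))))
      (PCFc.Tm.subst_liftSubst_weaken (A := PCFc.Ty.arr (ty A) (ty B)) σ (ty A) E)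

/-- The bounding relation `M ⊑ E`. At type `nat` it also asks that the potential of `E` has no
value other than the value of `M`. -/
def Bounds : ∀ A : PCF.Ty, PCF.Tm [] A → PCFc.Tm [] (ty A) → Prop
  | .nat, M, E => Bounded (PCFc.Tm.fst E) → ∃ n k : ℕ, PCF.Eval M (PCF.Tm.num k) n ∧
      SizeLE (PCFc.Tm.cnum n) (PCFc.Tm.fst E) ∧ SizeLE (PCFc.Tm.num k) (PCFc.Tm.snd E) ∧
      ∀ V, PCFc.Eval (PCFc.Tm.snd E) V → V = PCFc.Tm.num k
  | .prod A B, M, E =>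
      Bounds A (PCF.Tm.fst M) (PCFc.Tm.fst E) ∧ Bounds B (PCF.Tm.snd M) (PCFc.Tm.snd E)
  | .arr A B, M, E => ∀ (N : PCF.Tm [] A) (X : PCFc.Tm [] (ty A)),
      Bounds A N X → Bounds B (PCF.Tm.app M N) (PCFc.Tm.app E X)

namespace Bounds

theorem above {A : PCF.Ty} {M : PCF.Tm [] A} {E E' : PCFc.Tm [] (ty A)} (h : Bounds A M E)
    (hE : Above E' E) : Bounds A M E' := by
  induction A with
  | nat =>
    intro hb
    obtain ⟨n, k, hM, hc, hp, hv⟩ := h (Above.fst hE |>.bounded hb)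
    exact ⟨n, k, hM, hc.trans (Above.fst hE).1, hp.trans (Above.snd hE).1,
      fun V e => hv V ((Above.snd hE).2 V e)⟩
  | prod A B ihA ihB => exact ⟨ihA h.1 (Above.fst hE), ihB h.2 (Above.snd hE)⟩
  | arr A B _ ih => exact fun N X hX => ih (h N X hX) (Above.app hE X)

theorem expands {A : PCF.Ty} {M M' : PCF.Tm [] A} {E : PCFc.Tm [] (ty A)} (h : Bounds A M E)
    (hM : PCF.Expands 0 M' M) : Bounds A M' E := by
  induction A with
  | nat =>
    intro hb
    obtain ⟨n, k, e, h⟩ := h hb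
    exact ⟨n, k, by simpa only [zero_add] using hM _ _ e, h⟩
  | prod A B ihA ihB => exact ⟨ihA h.1 hM.fst, ihB h.2 hM.snd⟩
  | arr A B _ ih => exact fun N X hX => ih (h N X hX) (hM.app N)

/-- Charging a cost `L` pays for an expansion of `M` whose cost is bounded by `L`. -/
theorem charge_of_bounded {A : PCF.Ty} {M' : PCF.Tm [] A} {L : PCFc.Tm [] PCFc.Ty.cost}
    {E : PCFc.Tm [] (ty A)}
    (h : Bounded L → ∃ M c, Bounds A M E ∧ PCF.Expands c M' M ∧
      ∀ n, SizeLE (PCFc.Tm.cnum (c + n)) (PCFc.Tm.cplus L (PCFc.Tm.cnum n))) :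
    Bounds A M' (charge A L E) := by
  induction A with
  | nat =>
    intro hb
    -- The charged cost is L ⊞ E_c and sums evaluate both summands: its convergence releases the
    -- hypothesis guarded by `Bounded L` as well as the bound by `E`.
    obtain ⟨hL, hE⟩ := ((Above.fst_pair _ _).bounded hb).of_cplus
    obtain ⟨M, c, hME, hM, hc⟩ := h hL
    obtain ⟨n, k, e, hn, hk, hv⟩ := hME hE
    exact ⟨c + n, k, hM _ _ e,
      ((hc n).trans (.congr_cplus (.refl L) hn)).trans (.fst _ _),
      hk.trans (.snd _ _), fun V e => hv V ((Above.snd_pair _ _).2 V e)⟩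
  | prod A B ihA ihB =>
    constructor
    · refine above (ihA fun hL => ?_) (Above.fst_pair _ _)
      obtain ⟨M, c, hME, hM, hc⟩ := h hL
      exact ⟨_, c, hME.1, hM.fst, hc⟩
    · refine above (ihB fun hL => ?_) (Above.snd_pair _ _)
      obtain ⟨M, c, hME, hM, hc⟩ := h hL
      exact ⟨_, c, hME.2, hM.snd, hc⟩
  | arr A B _ ih =>
    intro N X hX
    refine above (E := charge B L (PCFc.Tm.app E X)) (ih fun hL => ?_) ?_
    · obtain ⟨M, c, hME, hM, hc⟩ := h hL
      exact ⟨_, c, hME N X hX, hM.app N, hc⟩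
    · have hb := Above.beta (charge B (L.weaken (ty A))
        (PCFc.Tm.app (E.weaken (ty A)) (PCFc.Tm.var Var.zero))) X
      rw [PCFc.Tm.inst, charge_subst] at hb
      simp only [PCFc.Tm.subst] at hb
      change Above _ (charge B ((L.weaken (ty A)).inst X)
        (PCFc.Tm.app ((E.weaken (ty A)).inst X) X)) at hb
      rwa [PCFc.Tm.inst_weaken, PCFc.Tm.inst_weaken] at hb

/-- Charging one unit pays for one step. -/
theorem charge_cone {A : PCF.Ty} {M M' : PCF.Tm [] A} {E : PCFc.Tm [] (ty A)} (h : Bounds A M E)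
    (hM : PCF.Expands 1 M' M) : Bounds A M' (charge A PCFc.Tm.cone E) :=
  -- The cost numeral of n + 1 is by definition 𝟏 ⊞ the numeral of n, so after commuting 1 + n
  -- reflexivity suffices.
  charge_of_bounded fun _ => ⟨M, 1, h, hM, fun n => by rw [add_comm]; exact .refl _⟩

/-- At `nat` the condition is vacuous once the cost diverges. The elimination context collects the
projections and applications met while descending through the type. -/
theorem of_not_bounded {A₀ : PCFc.Ty} {X : PCFc.Tm [] A₀} (hX : ¬ Bounded X) {A : PCF.Ty}
    (E : ECtx [] A₀ (ty A)) (M : PCF.Tm [] A) : Bounds A M (E.fill X) := by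
  induction A with
  | nat => exact fun hb => absurd hb (PCFc.not_bounded_eCtx hX (.fst E))
  | prod A B ihA ihB => exact ⟨ihA (.fst E) _, ihB (.snd E) _⟩
  | arr A B _ ih => exact fun N Y _ => ih (.app E Y) _

/-- Admissibility: a bound by every unfolding of a fixed point is a bound by the fixed point. -/
theorem of_fixn {A₀ : PCFc.Ty} {F : PCFc.Tm [A₀] A₀} {A : PCF.Ty} {E : ECtx [] A₀ (ty A)}
    {M : PCF.Tm [] A} (h : ∀ n, Bounds A M (E.fill (PCFc.Tm.fixn n F))) :
    Bounds A M (E.fill (PCFc.Tm.fix F)) := by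
  induction A with
  | nat =>
    rintro ⟨V, e⟩
    obtain ⟨n₀, hn₀⟩ := PCFc.Apx.exists_eval F e
    have hb : ∀ n, n₀ ≤ n → Bounded (PCFc.Tm.fst (E.fill (PCFc.Tm.fixn n F))) := fun n hn => by
      obtain ⟨V', e', -⟩ := hn₀ 0 _ (PCFc.Apx.ecFill (.fst E) (by omega : 0 + n₀ ≤ n))
      exact ⟨V', e'⟩
    obtain ⟨m, k, hM, -⟩ := h n₀ (hb n₀ le_rfl)
    -- Each late unfolding yields its own cost and numeral; determinism identifies them with `m` and
    -- `k`.
    have key : ∀ n, n₀ ≤ n →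
        SizeLE (PCFc.Tm.cnum m) (PCFc.Tm.fst (E.fill (PCFc.Tm.fixn n F))) ∧
        SizeLE (PCFc.Tm.num k) (PCFc.Tm.snd (E.fill (PCFc.Tm.fixn n F))) ∧
        ∀ V, PCFc.Eval (PCFc.Tm.snd (E.fill (PCFc.Tm.fixn n F))) V → V = PCFc.Tm.num k := by
      intro n hn
      obtain ⟨m', k', hM', h'⟩ := h n (hb n hn)
      obtain ⟨hk, rfl⟩ := hM.det hM'
      cases hk
      exact h'
    -- `cpind` asks for every n, while `key` starts at `n₀`. Since unfoldings decrease in the size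
    -- order, the bound at `max n₀ n` gives the one at n.
    refine ⟨m, k, hM, .cpind (.fst E) F fun n => ?_, .cpind (.snd E) F fun n => ?_, fun W e => ?_⟩
    · exact (key _ (le_max_left n₀ n)).1.trans
        ((SizeLE.fixn_antitone (le_max_right n₀ n)).congr_eCtx (.fst E))
    · exact (key _ (le_max_left n₀ n)).2.1.trans
        ((SizeLE.fixn_antitone (le_max_right n₀ n)).congr_eCtx (.snd E))
    · obtain ⟨n₁, hn₁⟩ := PCFc.Apx.exists_eval F e
      obtain ⟨W', e', a⟩ := hn₁ 0 _
        (PCFc.Apx.ecFill (.snd E) (by omega : 0 + n₁ ≤ max n₀ n₁))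
      -- The numeral `k` now approximates `W`, so `W` is that numeral or is `fix x. F` itself; the
      -- latter is not a value.
      rw [(key _ (le_max_left n₀ n₁)).2.2 W' e'] at a
      cases a with
      | unfold ρ j _ hj hW =>
        subst hW
        rw [PCFc.Tm.rename_closed] at e
        exact absurd rfl (e.ne_fix F)
      | num => rfl
  | prod A B ihA ihB =>
    exact ⟨ihA (E := .fst E) fun n => (h n).1, ihB (E := .snd E) fun n => (h n).2⟩
  | arr A B _ ih => exact fun N X hX => ih (E := .app E X) fun n => h n N X hX

theorem num (k : ℕ) : Bounds .nat (PCF.Tm.num k) (PCFc.Tm.pair PCFc.Tm.czero (PCFc.Tm.num k)) := by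
  refine fun _ => ⟨0, k, .num k, .fst _ _, .snd _ _, fun V e => ?_⟩
  cases (Above.snd_pair _ _).2 V e
  rfl

theorem op (o : ArithOp) {M N : PCF.Tm [] PCF.Ty.nat} {E X : PCFc.Tm [] (ty PCF.Ty.nat)}
    (hM : Bounds .nat M E) (hN : Bounds .nat N X) :
    Bounds .nat (PCF.Tm.op o M N)
      (PCFc.Tm.pair (PCFc.Tm.cplus (PCFc.Tm.fst E) (PCFc.Tm.fst X))
        (PCFc.Tm.op o (PCFc.Tm.snd E) (PCFc.Tm.snd X))) := by
  intro hb
  obtain ⟨hE, hX⟩ := ((Above.fst_pair _ _).bounded hb).of_cplus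
  obtain ⟨m, k, eM, hm, hk, hvM⟩ := hM hE
  obtain ⟨n, l, eN, hn, hl, hvN⟩ := hN hX
  refine ⟨m + n, o.eval k l, .op o eM eN,
    ((SizeLE.cnum_add m n).trans (.congr_cplus hm hn)).trans (.fst _ _),
    ((SizeLE.op o k l).trans (.congr_op o hk hl)).trans (.snd _ _), fun V e => ?_⟩
  have e' := (Above.snd_pair _ _).2 V e
  cases e' with
  | op _ e₁ e₂ =>
    cases hvM _ e₁
    cases hvN _ e₂
    rfl

/-- The charge is the cost of the test. Only if that cost converges is the numeral of the test
known, and with it the branch; hence the guarded hypothesis of `charge_of_bounded`. -/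
theorem ifz {A : PCF.Ty} {N : PCF.Tm [] PCF.Ty.nat} {P Q : PCF.Tm [] A}
    {X : PCFc.Tm [] (ty PCF.Ty.nat)} {E E' : PCFc.Tm [] (ty A)}
    (hN : Bounds .nat N X) (hP : Bounds A P E) (hQ : Bounds A Q E') :
    Bounds A (PCF.Tm.ifz N P Q)
      (charge A (PCFc.Tm.fst X) (PCFc.Tm.ifz (PCFc.Tm.snd X) E E')) := by
  refine charge_of_bounded fun hX => ?_
  obtain ⟨c, k, eN, hc, hk, hv⟩ := hN hX
  have hL : ∀ n, SizeLE (PCFc.Tm.cnum (c + n)) (PCFc.Tm.cplus (PCFc.Tm.fst X) (PCFc.Tm.cnum n)) :=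
    fun n => (SizeLE.cnum_add c n).trans (.congr_cplus hc (.refl _))
  cases k with
  | zero => exact ⟨P, c, hP.above (.ifz_zero E E' hk hv), fun V n e => .ifz_zero eN e, hL⟩
  | succ k => exact ⟨Q, c, hQ.above (.ifz_succ E E' hk hv), fun V n e => .ifz_succ eN e, hL⟩

/-- By admissibility it is enough to treat the unfoldings of `F`, all against the same source term.
Unfolding `fix` in the source is free, so no charge is needed. -/
theorem fix {A : PCF.Ty} {M : PCF.Tm [A] A} {F : PCFc.Tm [ty A] (ty A)}
    (h : ∀ N X, Bounds A N X → Bounds A (M.inst N) (F.inst X)) :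
    Bounds A (PCF.Tm.fix M) (PCFc.Tm.fix F) := by
  refine of_fixn (E := .hole) fun n => ?_
  induction n with
  | zero => exact of_not_bounded (PCFc.not_bounded_fixn_zero F) .hole _
  | succ n ih => exact (h _ _ ih).expands (.fix M)

/-- The extracted recurrence bounds the source term, under substitutions that are so related. -/
theorem tm_subst {Γ : List PCF.Ty} {A : PCF.Ty} (M : PCF.Tm Γ A)
    (σ : ∀ B, Var Γ B → PCF.Tm [] B) (τ : ∀ B, Var (Γ.map ty) B → PCFc.Tm [] B)
    (h : ∀ B (x : Var Γ B), Bounds B (σ B x) (τ (ty B) (Var.map ty x))) :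
    Bounds A (M.subst σ) ((tm M).subst τ) := by
  have hcons : ∀ {Δ : List PCF.Ty} (σ : ∀ B, Var Δ B → PCF.Tm [] B)
      (τ : ∀ B, Var (Δ.map ty) B → PCFc.Tm [] B)
      (_ : ∀ B (x : Var Δ B), Bounds B (σ B x) (τ (ty B) (Var.map ty x)))
      {C : PCF.Ty} {N : PCF.Tm [] C} {X : PCFc.Tm [] (ty C)} (_ : Bounds C N X)
      (B : PCF.Ty) (x : Var (C :: Δ) B),
      Bounds B (PCF.Tm.consSubst N σ B x) (PCFc.Tm.consSubst X τ (ty B) (Var.map ty x)) := by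
    intro Δ σ τ h C N X hX B x
    cases x with
    | zero => exact hX
    | succ x => exact h B x
  induction M with
  | var x => exact h _ x
  | num k => exact num k
  | op o M N ihM ihN => exact op o (ihM σ τ h) (ihN σ τ h)
  | ifz N P Q ihN ihP ihQ =>
    simp only [tm]
    rw [charge_subst]
    exact ifz (ihN σ τ h) (ihP σ τ h) (ihQ σ τ h)
  | pair M N ihM ihN =>
    simp only [tm, PCFc.Tm.subst]
    rw [charge_subst, charge_subst]
    -- The unit charged to each component pays for the projection in the source; in the recurrence
    -- the projection is just a head reduction.
    exact ⟨((ihM σ τ h).charge_cone (.fst_pair _ _)).above (.fst_pair _ _),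
      ((ihN σ τ h).charge_cone (.snd_pair _ _)).above (.snd_pair _ _)⟩
  | fst M ih => exact (ih σ τ h).1
  | snd M ih => exact (ih σ τ h).2
  | lam M ih =>
    intro N X hX
    -- The body is used under the substitutions extended by the arguments `N` and `X`; the unit
    -- charged to it pays for the source β-step.
    have hM := ih _ _ (hcons σ τ h hX)
    rw [← PCF.Tm.inst_subst_liftSubst] at hM
    refine above (hM.charge_cone (.beta _ N)) ?_
    have hb := Above.beta ((charge _ PCFc.Tm.cone (tm M)).subst (PCFc.Tm.liftSubst τ _)) X
    rw [PCFc.Tm.inst_subst_liftSubst, charge_subst _ (PCFc.Tm.consSubst X τ)] at hb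
    exact hb
  | app M N ihM ihN => exact ihM σ τ h _ _ (ihN σ τ h)
  | fix M ih =>
    refine fix fun N X hX => ?_
    rw [PCF.Tm.inst_subst_liftSubst, PCFc.Tm.inst_subst_liftSubst]
    exact ih _ _ (hcons σ τ h hX)

end Bounds

end Extraction

theorem mainTheorem3 :
    ∃ R : ∀ A : PCF.Ty, PCF.Tm [] A → PCFc.Tm [] (Extraction.ty A) → Prop,
      (∀ (M : PCF.Tm [] PCF.Ty.nat) (E : PCFc.Tm [] (Extraction.ty PCF.Ty.nat)),
        R PCF.Ty.nat M E →
          PCFc.Bounded (PCFc.Tm.fst E) →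
            ∃ n k : ℕ,
              PCF.Eval M (PCF.Tm.num k) n ∧
              PCFc.SizeLE (PCFc.Tm.cnum n) (PCFc.Tm.fst E) ∧
              PCFc.SizeLE (PCFc.Tm.num k) (PCFc.Tm.snd E)) ∧
      (∀ (A₁ A₂ : PCF.Ty) (M : PCF.Tm [] (PCF.Ty.prod A₁ A₂))
          (E : PCFc.Tm [] (Extraction.ty (PCF.Ty.prod A₁ A₂))),
        R (PCF.Ty.prod A₁ A₂) M E →
          R A₁ (PCF.Tm.fst M) (PCFc.Tm.fst E) ∧ R A₂ (PCF.Tm.snd M) (PCFc.Tm.snd E)) ∧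
      (∀ (A B : PCF.Ty) (M : PCF.Tm [] (PCF.Ty.arr A B))
          (E : PCFc.Tm [] (Extraction.ty (PCF.Ty.arr A B))),
        R (PCF.Ty.arr A B) M E →
          ∀ (N : PCF.Tm [] A) (X : PCFc.Tm [] (Extraction.ty A)),
            R A N X → R B (PCF.Tm.app M N) (PCFc.Tm.app E X)) ∧
      (∀ (A : PCF.Ty) (M : PCF.Tm [] A), R A M (Extraction.tm M)) := by
  refine ⟨Extraction.Bounds, fun M E h hb => ?_, fun _ _ _ _ h => h, fun _ _ _ _ h => h,
    fun A M => ?_⟩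
  · obtain ⟨n, k, e, hc, hp, -⟩ := h hb
    exact ⟨n, k, e, hc, hp⟩
  · have h := Extraction.Bounds.tm_subst M (fun _ x => PCF.Tm.var x) (fun _ x => PCFc.Tm.var x)
      fun _ x => nomatch x
    rw [PCF.Tm.subst_var] at h
    exact (PCFc.Tm.subst_var (Extraction.tm M)) ▸ h
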